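/- All vocabularies are finite and relational, and all structures are finite and nonempty. Let $\mathcal{L}^k$ be the infinitary logic with $k$ variables (first-order atoms, negation, arbitrary conjunctions and disjunctions, quantifiers $\exists,\forall$, using only the variables $x_1,\dots,x_k$). For a class $\mathcal{K}$ of structures over a vocabulary $\tau=\{R_1,\dots,R_m\}$ that is closed under isomorphism, the generalized quantifier $Q_{\mathcal{K}}$ binds tuples $\bar y_1,\dots,\bar y_m$ of distinct variables, with $|\bar y_i|$ the arity of $R_i$, in formulas $\psi_1,\dots,\psi_m$; the formula $Q_{\mathcal K}\bar y_1,\dots,\bar y_m(\psi_1,\dots,\psi_m)$ holds in $\mathbf{A}$ under an assignment $\alpha$ if the $\tau$-structure with universe $A$ and relations $\{\bar b\mid (\mathbf{A},\alpha[\bar b/\bar y_i])\models\psi_i\}$ lies in $\mathcal{K}$. The arity of $Q_{\mathcal K}$ is the maximum arity of the symbols in $\tau$. For a collection $\mathcal{Q}$ of quantifiers let $\mathcal{L}(\mathcal{Q})=\bigcup_{k}\mathcal{L}^k(\mathcal{Q})$, where $\mathcal{L}^k(\mathcal{Q})$ extends $\mathcal{L}^k$ by the quantifiers in $\mathcal{Q}$.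 Write $\mathcal{L}(\mathcal{Q})\le\mathcal{L}(\mathcal{Q}')$ if over every vocabulary every sentence of $\mathcal{L}(\mathcal{Q})$ is equivalent to a sentence of $\mathcal{L}(\mathcal{Q}')$, and $\mathcal{L}(\mathcal{Q})\lneq\mathcal{L}(\mathcal{Q}')$ if $\mathcal{L}(\mathcal{Q})\le\mathcal{L}(\mathcal{Q}')$ but $\mathcal{L}(\mathcal{Q}')\not\le\mathcal{L}(\mathcal{Q})$. For $\ell\ge 3$, the $\ell$-ary partial near-unanimity function $n^\ell$ on a set $A$ has the value $n^\ell(a_1,\dots,a_\ell)=a$ if at least $\ell-1$ of the $a_i$ are equal to $a$, and is undefined otherwise. For a structure $\mathbf{B}$, let $n^\ell(\mathbf{B})$ be the structure on the same universe whose relations consist of all tuples obtained by applying $n^\ell$ componentwise to $\ell$ tuples of the corresponding relation of $\mathbf{B}$. The quantifier $Q_{\mathcal{K}}$ is $\mathcal{N}^\ell$-closed if for every $\mathbf{B}\in\mathcal{K}$, every structure $\mathbf{A}$ on the same universe whose relations satisfy $R^{\mathbf{A}}\subseteq R^{\mathbf{B}}\cup R^{n^\ell(\mathbf{B})}$ is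 also in $\mathcal{K}$. It is a CSP quantifier if, for some structure $\mathbf{B}$, $\mathcal{K}$ is the class of all $\mathbf{A}$ that admit a homomorphism to $\mathbf{B}$. Let $\mathcal{Q}_r$ be the collection of all quantifiers of arity at most $r$, and $\mathcal{Q}_r^{\mathcal{N}^\ell_{\mathrm{CSP}}}$ the collection of all $\mathcal{N}^\ell$-closed CSP quantifiers of arity at most $r$. Theorem. Let $r\ge\ell\ge 3$. Then $$\mathcal{L}\bigl(\mathcal{Q}^{\mathcal{N}^\ell_{\mathrm{CSP}}}_{q(r,\ell)}\bigr)\not\le\mathcal{L}(\mathcal{Q}_r),\qquad\text{where } q(r,\ell)=(2r+1)\Bigl(\Bigl\lfloor\frac{2r+1}{\ell-1}\Bigr\rfloor+2\Bigr).$$ In particular, there is an $r'>r$ such that $\mathcal{L}\bigl(\mathcal{Q}^{\mathcal{N}^\ell_{\mathrm{CSP}}}_{r}\bigr)\lneq\mathcal{L}\bigl(\mathcal{Q}^{\mathcal{N}^\ell_{\mathrm{CSP}}}_{r'}\bigr)$. -/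

import Mathlib

namespace PolyQuant

open scoped FirstOrder

/-- A finite nonempty structure over the language `L`. -/
structure FinStr (L : FirstOrder.Language.{0, 0}) where
  carrier : Type
  str : L.Structure carrier
  finite : Finite carrier
  nonempty : Nonempty carrier

attribute [instance] FinStr.str FinStr.finite FinStr.nonempty

/-- A generalized (Lindström) quantifier: a finite relational vocabulary together with an
isomorphism-closed class of finite structures over it. -/
structure Quantifier where
  voc : FirstOrder.Language.{0, 0}
  relational : voc.IsRelational
  finite_voc : Finite (Σ n, voc.Relations n)
  cls : Set (FinStr voc)
  iso_closed : ∀ A B : FinStr voc, A ∈ cls → Nonempty (A.carrier ≃[voc] B.carrier) → B ∈ cls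

attribute [instance] Quantifier.relational Quantifier.finite_voc

/-- The formulas of `𝓛^k(𝒬)` over the vocabulary `σ`: infinitary formulas with the variables
`x_0, …, x_{k-1}` and with the generalized quantifiers in `𝒬`. Disjunctions and universal
quantifiers are expressed by negation. In `Q_K ȳ_1, …, ȳ_m (ψ_1, …, ψ_m)` there are, for every
relation symbol `R` of the vocabulary of `K`, a tuple `y R` of distinct variables, of length the
arity of `R`, and a formula `ψ R`. -/
inductive Formula (σ : FirstOrder.Language.{0, 0}) (𝒬 : Set Quantifier) (k : ℕ) : Type 1
  | eq (x y : Fin k) : Formula σ 𝒬 k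
  | rel {n : ℕ} (R : σ.Relations n) (x : Fin n → Fin k) : Formula σ 𝒬 k
  | neg (φ : Formula σ 𝒬 k) : Formula σ 𝒬 k
  | conj {ι : Type} (φ : ι → Formula σ 𝒬 k) : Formula σ 𝒬 k
  | ex (x : Fin k) (φ : Formula σ 𝒬 k) : Formula σ 𝒬 k
  | quant (Q : Quantifier) (hQ : Q ∈ 𝒬) (y : ∀ {n : ℕ}, Q.voc.Relations n → (Fin n ↪ Fin k))
      (ψ : ∀ {n : ℕ}, Q.voc.Relations n → Formula σ 𝒬 k) : Formula σ 𝒬 k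

/-- The set of free variables of a formula. -/
def Formula.freeVars {σ : FirstOrder.Language.{0, 0}} {𝒬 : Set Quantifier} {k : ℕ} :
    Formula σ 𝒬 k → Set (Fin k)
  | .eq x y => {x, y}
  | .rel _ x => Set.range x
  | .neg φ => φ.freeVars
  | .conj φ => ⋃ i, (φ i).freeVars
  | .ex x φ => φ.freeVars \ {x}
  | .quant Q _ y ψ => ⋃ (n : ℕ) (R : Q.voc.Relations n), (ψ R).freeVars \ Set.range (y R)

/-- The structure over a relational vocabulary with the given relations. -/
@[reducible]
def relStructure (L : FirstOrder.Language.{0, 0}) [L.IsRelational] (A : Type)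
    (rel : ∀ {n : ℕ}, L.Relations n → (Fin n → A) → Prop) : L.Structure A where
  funMap f := isEmptyElim f
  RelMap := rel

/-- Satisfaction `(A, α) ⊨ φ`. Here `Function.extend (y R) b α` is the assignment `α[b/y_R]`. -/
def Formula.Holds {σ : FirstOrder.Language.{0, 0}} {𝒬 : Set Quantifier} {k : ℕ} (A : FinStr σ) :
    Formula σ 𝒬 k → (Fin k → A.carrier) → Prop
  | .eq x y, α => α x = α y
  | .rel R x, α => FirstOrder.Language.Structure.RelMap R (fun i => α (x i))
  | .neg φ, α => ¬ φ.Holds A α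
  | .conj φ, α => ∀ i, (φ i).Holds A α
  | .ex x φ, α => ∃ a : A.carrier, φ.Holds A (Function.update α x a)
  | .quant Q _ y ψ, α =>
      (⟨A.carrier,
        relStructure Q.voc A.carrier (fun R b => (ψ R).Holds A (Function.extend (y R) b α)),
        A.finite, A.nonempty⟩ : FinStr Q.voc) ∈ Q.cls

/-- A sentence of `𝓛(𝒬) = ⋃ₖ 𝓛^k(𝒬)` over the vocabulary `σ`. -/
structure Sentence (σ : FirstOrder.Language.{0, 0}) (𝒬 : Set Quantifier) where
  numVars : ℕ
  formula : Formula σ 𝒬 numVars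
  closed : formula.freeVars = ∅

/-- `A ⊨ φ` for a sentence `φ` (the choice of the assignment is irrelevant). -/
def Sentence.Models {σ : FirstOrder.Language.{0, 0}} {𝒬 : Set Quantifier} (A : FinStr σ)
    (φ : Sentence σ 𝒬) : Prop :=
  ∀ α : Fin φ.numVars → A.carrier, φ.formula.Holds A α

/-- `𝓛(𝒬) ≤ 𝓛(𝒬')`: over every finite relational vocabulary, every sentence of `𝓛(𝒬)` is
equivalent, on finite structures, to a sentence of `𝓛(𝒬')`. -/
def LogicLE (𝒬 𝒬' : Set Quantifier) : Prop :=
  ∀ (σ : FirstOrder.Language.{0, 0}) [σ.IsRelational] [Finite (Σ n, σ.Relations n)] (φ : Sentence σ 𝒬),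
    ∃ ψ : Sentence σ 𝒬', ∀ A : FinStr σ, φ.Models A ↔ ψ.Models A

/-- `𝒬_r`: the quantifiers of arity at most `r`. -/
def quantifiersOfArity (r : ℕ) : Set Quantifier :=
  {Q | ∀ n, Nonempty (Q.voc.Relations n) → n ≤ r}

/-- The CSP quantifiers: the class is `{A | A → B}` for some template `B`. -/
def cspQuantifiers : Set Quantifier :=
  {Q | ∃ B : FinStr Q.voc, ∀ A : FinStr Q.voc,
    A ∈ Q.cls ↔ Nonempty (A.carrier →[Q.voc] B.carrier)}

/-- The relation `p(R)`, obtained from `R ⊆ Aⁿ` by applying the partial function `p` of arity `ℓ`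
columnwise to tuples in `R`. -/
def imageRel {A : Type} {ℓ n : ℕ} (p : (Fin ℓ → A) →. A) (R : (Fin n → A) → Prop) :
    (Fin n → A) → Prop :=
  fun b => ∃ a : Fin ℓ → Fin n → A, (∀ i, R (a i)) ∧ ∀ j, b j ∈ p (fun i => a i j)

/-- The quantifiers closed under the family `P` of partial functions: if `B` is in the class and
`A ≤ B ∪ P(B)` (on the same universe), then `A` is in the class. -/
def closedQuantifiers {ℓ : ℕ} (P : ∀ A : Type, (Fin ℓ → A) →. A) : Set Quantifier :=
  {Q | ∀ (U : Type) (hf : Finite U) (hn : Nonempty U) (A B : Q.voc.Structure U),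
    (⟨U, B, hf, hn⟩ : FinStr Q.voc) ∈ Q.cls →
    (∀ (n : ℕ) (R : Q.voc.Relations n) (x : Fin n → U),
      A.RelMap R x → B.RelMap R x ∨ imageRel (P U) (B.RelMap R) x) →
    (⟨U, A, hf, hn⟩ : FinStr Q.voc) ∈ Q.cls}

/-- The partial near-unanimity function of arity `ℓ`: its value is `c` if at least `ℓ - 1` of the
inputs are equal to `c`, and it is undefined if there is no such `c`. -/
noncomputable def nearUnanimity (ℓ : ℕ) (A : Type) : (Fin ℓ → A) →. A :=
  fun a => ⟨∃ c, ℓ ≤ {i | a i = c}.ncard + 1, fun h => h.choose⟩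

theorem mem_nearUnanimity {ℓ : ℕ} (hℓ : 3 ≤ ℓ) {A : Type} (a : Fin ℓ → A) (c : A) :
    c ∈ nearUnanimity ℓ A a ↔ ℓ ≤ {i | a i = c}.ncard + 1 := by
  constructor
  · rintro ⟨h, rfl⟩
    exact h.choose_spec
  · intro hc
    refine ⟨⟨c, hc⟩, ?_⟩
    have h : ∃ c, ℓ ≤ {i | a i = c}.ncard + 1 := ⟨c, hc⟩
    change h.choose = c
    have hd := h.choose_spec
    set d := h.choose
    by_contra hne
    have hdisj : Disjoint {i | a i = d} {i | a i = c} := by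
      rw [Set.disjoint_left]
      intro i hi hi'
      exact hne (hi.symm.trans hi')
    have h1 := Set.ncard_union_eq hdisj (Set.toFinite _) (Set.toFinite _)
    have h2 := Set.ncard_le_ncard (Set.subset_univ ({i | a i = d} ∪ {i | a i = c}))
      (Set.toFinite _)
    rw [Set.ncard_univ, Nat.card_fin] at h2
    omega

/-- The `𝒩^ℓ`-closed CSP quantifiers of arity at most `r`. -/
noncomputable def nuCSPQuantifiers (ℓ r : ℕ) : Set Quantifier :=
  closedQuantifiers (nearUnanimity ℓ) ∩ cspQuantifiers ∩ quantifiersOfArity r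

/-- `q(r, ℓ) = (2r+1)(⌊(2r+1)/(ℓ-1)⌋ + 2)` (used for `ℓ ≥ 3`). -/
def separationArity (r ℓ : ℕ) : ℕ :=
  (2 * r + 1) * ((2 * r + 1) / (ℓ - 1) + 2)

end PolyQuant

namespace PolyQuant

open FirstOrder.Language
open scoped FirstOrder

/-! The argument is of Cai–Fürer–Immerman type. The template's relation consists of codes of the
even-parity words of length `2r + 1`. A code records every bit and its complement, and also pairs of
bits that include all pairs with indices congruent modulo `ℓ - 1`. The pairs give closure under
partial near-unanimity (`mem_evenCodes_of_failsOnce`): if the result differed from all `ℓ` input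
words, two of the `ℓ` differences would sit at congruent indices, and some coordinate would fail in
two rows, whereas each coordinate tolerates only one.

On a bipartite torus graph of degree `m + 1`, with `m = 2r`, put a bit on every edge and demand
parity `b v` at every vertex `v`. For `b = 0` the structure maps to the template. If `b` has odd sum
it does not, because a homomorphism yields a set of edges with boundary `b`, and every edge has two
ends.

The structures for `b = 0` and for `b` supported at one vertex differ by a single defect, which
flipping bits moves along paths. In the bijective game the duplicator first moves the defect to a
point with `m + 1` edge-disjoint escape routes. The `r` new elements touch at most `2r = m` edges,
so one route stays open (`exists_safe_flow`), and arity-`r` quantifiers cannot distinguish the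
structures (`BijectiveStrategy.holds_iff`). The side of the torus grows with the number of
variables, but the degree, and so the arity of the template, depends only on `r` and `ℓ`. -/

theorem Quantifier.mem_iff_of_equiv (Q : Quantifier) (A B : FinStr Q.voc)
    (f : A.carrier ≃ B.carrier)
    (h : ∀ {n : ℕ} (R : Q.voc.Relations n) (x : Fin n → A.carrier),
      Structure.RelMap R (f ∘ x) ↔ Structure.RelMap R x) : A ∈ Q.cls ↔ B ∈ Q.cls := by
  let g : A.carrier ≃[Q.voc] B.carrier :=
    { f with
      map_fun' := fun F => isEmptyElim F
      map_rel' := fun R x => h R x }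
  exact ⟨fun hA => Q.iso_closed A B hA ⟨g⟩, fun hB => Q.iso_closed B A hB ⟨g.symm⟩⟩

/-! ### The bijective game -/

/-- A winning strategy for the duplicator in the `r`-bijective `k`-pebble game: a set of positions
that preserves atoms, and in which the duplicator can answer with a bijection. -/
structure BijectiveStrategy {σ : FirstOrder.Language.{0, 0}} (A B : FinStr σ) (r k : ℕ)
    (W : (Fin k → A.carrier) → (Fin k → B.carrier) → Prop) : Prop where
  eq_iff : ∀ {α β}, W α β → ∀ x y, α x = α y ↔ β x = β y
  rel_iff : ∀ {α β}, W α β → ∀ {n : ℕ} (R : σ.Relations n) (x : Fin n → Fin k),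
    Structure.RelMap R (fun i => α (x i)) ↔ Structure.RelMap R (fun i => β (x i))
  bijection : ∀ {α β}, W α β → ∃ f : A.carrier ≃ B.carrier, ∀ n ≤ r, ∀ (y : Fin n ↪ Fin k)
    (b : Fin n → A.carrier), W (Function.extend y b α) (Function.extend y (f ∘ b) β)

theorem update_eq_extend {k : ℕ} {A : Type*} (α : Fin k → A) (x : Fin k) (a : A) :
    Function.update α x a = Function.extend (fun _ : Fin 1 => x) (fun _ => a) α := by
  have hinj : Function.Injective (fun _ : Fin 1 => x) := fun _ _ _ => Subsingleton.elim _ _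
  ext j
  by_cases hj : j = x
  · subst hj
    simpa using (hinj.extend_apply (fun _ => a) α 0).symm
  · rw [Function.update_of_ne hj, Function.extend_apply']
    rintro ⟨_, h⟩
    exact hj h.symm

/-- At a generalized quantifier the induction hypothesis makes the duplicator's bijection an
isomorphism between the two defined structures. An existential quantifier is the case of 1-tuples,
hence `1 ≤ r`. -/
theorem BijectiveStrategy.holds_iff {σ : FirstOrder.Language.{0, 0}} {A B : FinStr σ} {r k : ℕ}
    {W : (Fin k → A.carrier) → (Fin k → B.carrier) → Prop} (h : BijectiveStrategy A B r k W)
    (hr : 1 ≤ r) (φ : Formula σ (quantifiersOfArity r) k) :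
    ∀ {α β}, W α β → (φ.Holds A α ↔ φ.Holds B β) := by
  induction φ with
  | eq x y => exact fun hW => h.eq_iff hW x y
  | rel R x => exact fun hW => h.rel_iff hW R x
  | neg φ ih => exact fun hW => not_congr (ih hW)
  | conj φ ih => exact fun hW => forall_congr' fun i => ih i hW
  | ex x φ ih =>
    intro α β hW
    obtain ⟨f, hf⟩ := h.bijection hW
    have hstep (a : A.carrier) :
        φ.Holds A (Function.update α x a) ↔ φ.Holds B (Function.update β x (f a)) := by
      apply ih
      rw [update_eq_extend, update_eq_extend]
      exact hf 1 hr ⟨fun _ => x, fun _ _ _ => Subsingleton.elim _ _⟩ fun _ => a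
    exact (exists_congr hstep).trans
      (f.surjective.exists (p := fun b => φ.Holds B (Function.update β x b))).symm
  | quant Q hQ y ψ ih =>
    intro α β hW
    obtain ⟨f, hf⟩ := h.bijection hW
    refine Q.mem_iff_of_equiv _ _ f fun {n} R b => ?_
    exact (ih R (hf n (hQ n ⟨R⟩) (y R) b)).symm

theorem LogicLE.of_subset {𝒬 𝒬' : Set Quantifier} (h : 𝒬 ⊆ 𝒬') : LogicLE 𝒬 𝒬' := by
  intro σ _ _ φ
  let lift {k : ℕ} (χ : Formula σ 𝒬 k) : Formula σ 𝒬' k :=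
    χ.rec (motive := fun _ => Formula σ 𝒬' k) .eq .rel (fun _ => .neg) (fun _ => .conj)
      (fun x _ => .ex x) (fun Q hQ y _ ψ => .quant Q (h hQ) y ψ)
  have hfree {k : ℕ} (χ : Formula σ 𝒬 k) : (lift χ).freeVars = χ.freeVars := by
    induction χ with
    | eq | rel => rfl
    | neg φ ih => exact ih
    | conj φ ih => exact Set.iUnion_congr ih
    | ex x φ ih => exact congrArg (· \ {x}) ih
    | quant Q hQ y ψ ih =>
      exact Set.iUnion_congr fun n => Set.iUnion_congr fun R =>
        congrArg (· \ Set.range (y R)) (ih R)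
  have hholds {k : ℕ} (A : FinStr σ) (χ : Formula σ 𝒬 k) :
      ∀ α, (lift χ).Holds A α ↔ χ.Holds A α := by
    induction χ with
    | eq | rel => exact fun _ => Iff.rfl
    | neg φ ih => exact fun α => not_congr (ih α)
    | conj φ ih => exact fun α => forall_congr' fun i => ih i α
    | ex x φ ih => exact fun α => exists_congr fun a => ih _
    | quant Q hQ y ψ ih =>
      exact fun α => Q.mem_iff_of_equiv _ _ (Equiv.refl _) fun R b => (ih R _).symm
  exact ⟨⟨φ.numVars, lift φ.formula, (hfree _).trans φ.closed⟩,
    fun A => forall_congr' fun α => (hholds A _ α).symm⟩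

theorem LogicLE.trans {𝒬₁ 𝒬₂ 𝒬₃ : Set Quantifier} (h : LogicLE 𝒬₁ 𝒬₂) (h' : LogicLE 𝒬₂ 𝒬₃) :
    LogicLE 𝒬₁ 𝒬₃ := by
  intro σ _ _ φ
  obtain ⟨ψ, hψ⟩ := h σ φ
  obtain ⟨χ, hχ⟩ := h' σ ψ
  exact ⟨χ, fun A => (hψ A).trans (hχ A)⟩

/-! ### A regular bipartite graph with many edge-disjoint escape routes -/

/-- The points of the `m`-dimensional discrete torus. -/
abbrev Cell (m N : ℕ) := Fin m → ZMod N

/-- The edge `(g, l)` joins the left vertex at `g` to the right vertex at `g + shift l`. -/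
abbrev Edge (m N : ℕ) := Cell m N × Fin (m + 1)

/-- Every point carries a left (`false`) and a right (`true`) vertex. -/
abbrev Vertex (m N : ℕ) := Cell m N × Bool

/-- The displacement along edges with label `l`. -/
def shift {m N : ℕ} (l : Fin (m + 1)) : Cell m N :=
  Fin.cases 0 (fun i => Pi.single i 1) l

@[simp] theorem shift_zero {m N : ℕ} : (shift 0 : Cell m N) = 0 := rfl

@[simp] theorem shift_succ {m N : ℕ} (i : Fin m) : (shift i.succ : Cell m N) = Pi.single i 1 := rfl

/-- The edge with label `l` at the vertex `v`. -/
def edgeAt {m N : ℕ} (v : Vertex m N) (l : Fin (m + 1)) : Edge m N :=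
  (if v.2 then v.1 - shift l else v.1, l)

/-- The `ZMod 2`-boundary of a set of edges. -/
def boundary {m N : ℕ} (c : Edge m N → ZMod 2) (v : Vertex m N) : ZMod 2 :=
  ∑ l, c (edgeAt v l)

theorem boundary_add {m N : ℕ} (c c' : Edge m N → ZMod 2) :
    boundary (c + c') = boundary c + boundary c' := by
  ext v
  simp [boundary, Finset.sum_add_distrib]

/-- Every edge is counted twice, once at its left and once at its right end. -/
theorem sum_boundary {m N : ℕ} [NeZero N] (c : Edge m N → ZMod 2) : ∑ v, boundary c v = 0 := by
  simp only [boundary, edgeAt, Fintype.sum_prod_type, Fintype.sum_bool, if_true, Bool.false_eq_true,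
    if_false, Finset.sum_add_distrib]
  rw [Finset.sum_comm]
  have h (l : Fin (m + 1)) : ∑ g : Cell m N, c (g - shift l, l) = ∑ g, c (g, l) :=
    Equiv.sum_comp (Equiv.subRight (shift l)) fun g => c (g, l)
  simp only [h]
  rw [Finset.sum_comm]
  exact CharTwo.add_self_eq_zero _

theorem boundary_single {m N : ℕ} (g : Cell m N) (l : Fin (m + 1)) :
    boundary (Pi.single (g, l) 1) = Pi.single (g, false) 1 + Pi.single (g + shift l, true) 1 := by
  ext ⟨g', s⟩
  cases s
  · by_cases h : g' = g <;> simp [boundary, edgeAt, Pi.single_apply, h]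
  · by_cases h : g' = g + shift l
    · simp only [boundary, edgeAt, Pi.single_apply, h, if_true, Prod.mk.injEq, Pi.add_apply]
      rw [Finset.sum_eq_single l] <;> simp +contextual
    · have h' : ∀ l', ¬ (g' - shift l' = g ∧ l' = l) := by
        rintro l' ⟨rfl, rfl⟩
        simp at h
      simp [boundary, edgeAt, h, h']

/-- There is a set of edges, disjoint from `F`, with boundary `{v, w}`. -/
def Flow {m N : ℕ} (F : Finset (Edge m N)) (v w : Vertex m N) : Prop :=
  ∃ c : Edge m N → ZMod 2, (∀ e ∈ F, c e = 0) ∧ boundary c = Pi.single v 1 + Pi.single w 1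

namespace Flow

variable {m N : ℕ} {F : Finset (Edge m N)} {u v w : Vertex m N}

theorem refl : Flow F v v := by
  refine ⟨0, fun _ _ => rfl, ?_⟩
  ext x
  simp [boundary, CharTwo.add_self_eq_zero]

theorem symm : Flow F v w → Flow F w v := by
  rintro ⟨c, hc, h⟩
  exact ⟨c, hc, h.trans (add_comm _ _)⟩

theorem trans : Flow F u v → Flow F v w → Flow F u w := by
  rintro ⟨c, hc, h⟩ ⟨c', hc', h'⟩
  refine ⟨c + c', fun e he => by simp [hc e he, hc' e he], ?_⟩
  rw [boundary_add, h, h']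
  ext x
  simp only [Pi.add_apply]
  linear_combination CharTwo.add_self_eq_zero ((Pi.single v 1 : Vertex m N → ZMod 2) x)

theorem edge {g : Cell m N} {l : Fin (m + 1)} (h : (g, l) ∉ F) :
    Flow F (g, false) (g + shift l, true) := by
  refine ⟨Pi.single (g, l) 1, fun e he => ?_, boundary_single g l⟩
  rw [Pi.single_apply, if_neg]
  rintro rfl
  exact h he

theorem sides {g : Cell m N} (h : (g, 0) ∉ F) : Flow F (g, false) (g, true) := by
  simpa using edge h

end Flow

/-- No edge of `F` starts in the hyperplane `x_j = t`. -/
def FreeAt {m N : ℕ} (F : Finset (Edge m N)) (j : Fin m) (t : ZMod N) : Prop :=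
  ∀ e ∈ F, e.1 j ≠ t

/-- The vertices that lie in a hyperplane in which no edge of `F` starts. -/
def Safe {m N : ℕ} (F : Finset (Edge m N)) (v : Vertex m N) : Prop :=
  ∃ j, FreeAt F j (v.1 j)

/-! ### Moving the defect within free hyperplanes -/

section Torus

variable {m N : ℕ} {F : Finset (Edge m N)}

theorem FreeAt.notMem {j : Fin m} {g : Cell m N} (h : FreeAt F j (g j)) (l : Fin (m + 1)) :
    (g, l) ∉ F :=
  fun hg => h _ hg rfl

/-- The path zigzags: out along label `i.succ`, back to the left side along label `0`. As `j ≠ i`,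
all its edges start in the free hyperplane. -/
theorem Flow.translate {i j : Fin m} (hij : j ≠ i) (n : ℕ) {g : Cell m N}
    (h : FreeAt F j (g j)) : Flow F (g, false) (g + Pi.single i (n : ZMod N), false) := by
  induction n with
  | zero => simpa using Flow.refl
  | succ n ih =>
    have h' (n : ℕ) : FreeAt F j ((g + Pi.single i (n : ZMod N) : Cell m N) j) := by simpa [hij] using h
    have h1 := Flow.edge ((h' n).notMem i.succ)
    rw [shift_succ, add_assoc, ← Pi.single_add, ← Nat.cast_succ] at h1
    exact ih.trans (h1.trans (Flow.sides ((h' (n + 1)).notMem 0)).symm)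

theorem Flow.update [NeZero N] {i j : Fin m} (hij : j ≠ i) {g : Cell m N}
    (h : FreeAt F j (g j)) (t : ZMod N) : Flow F (g, false) (Function.update g i t, false) := by
  have h1 := Flow.translate hij (t - g i).val h
  convert h1 using 2
  ext i'
  by_cases hi : i' = i
  · subst hi
    simp
  · simp [hi]

/-- Inside the free hyperplane of `v` all coordinates except `j` can be set to those of `z`. Then
the path lies in a free hyperplane of `z` in another direction, where coordinate `j` can be
corrected; this needs `2 ≤ m`. -/
theorem Safe.flow_of_forall_freeAt [NeZero N] (hm : 2 ≤ m) {v : Vertex m N} (hv : Safe F v)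
    {z : Cell m N} (hz : ∀ j, FreeAt F j (z j)) : Flow F v (z, false) := by
  obtain ⟨g, s⟩ := v
  obtain ⟨j, hj⟩ := hv
  have hs : Flow F (g, s) (g, false) := by
    cases s
    · exact .refl
    · exact (Flow.sides (hj.notMem 0)).symm
  have hS (S : Finset (Fin m)) : j ∉ S → Flow F (g, false) (S.piecewise z g, false) := by
    induction S using Finset.induction_on with
    | empty =>
      rw [Finset.piecewise_empty]
      exact fun _ => .refl
    | insert i S hi ih =>
      intro hjS
      rw [Finset.mem_insert, not_or] at hjS
      rw [Finset.piecewise_insert]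
      refine (ih hjS.2).trans (Flow.update hjS.1 ?_ _)
      simpa [hjS.2] using hj
  have : Nontrivial (Fin m) := Fin.nontrivial_iff_two_le.mpr hm
  obtain ⟨j', hj'⟩ := exists_ne j
  refine hs.trans ((hS (Finset.univ.erase j) (by simp)).trans ?_)
  have h1 := Flow.update (F := F) (g := (Finset.univ.erase j).piecewise z g) hj'
    (by simpa [hj'] using hz j') (z j)
  rwa [← Finset.piecewise_insert, Finset.insert_erase (Finset.mem_univ j),
    Finset.piecewise_univ] at h1

theorem exists_freeAt [NeZero N] (F : Finset (Edge m N)) (j : Fin m) (S : Finset (ZMod N))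
    (h : F.card < S.card) : ∃ t ∈ S, FreeAt F j t := by
  obtain ⟨t, hS, ht⟩ := Finset.exists_mem_notMem_of_card_lt_card
    ((Finset.card_image_le (s := F) (f := fun e => e.1 j)).trans_lt h)
  exact ⟨t, hS, fun e he h => ht (Finset.mem_image.mpr ⟨e, he, h⟩)⟩

/-- Each blocked edge rules out at most two values of each coordinate. The hyperplane at `z j - 1`
is where one of the escape routes ends. -/
theorem exists_forall_freeAt [NeZero N] (F : Finset (Edge m N)) (h : 2 * F.card < N) :
    ∃ z : Cell m N, ∀ j, FreeAt F j (z j) ∧ FreeAt F j (z j - 1) := by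
  refine ⟨_, fun j => Classical.choose_spec (p := fun t => FreeAt F j t ∧ FreeAt F j (t - 1)) ?_⟩
  let B := F.image (fun e => e.1 j) ∪ F.image (fun e => e.1 j + 1)
  have hB : B.card < (Finset.univ : Finset (ZMod N)).card := by
    rw [Finset.card_univ, ZMod.card]
    refine ((Finset.card_union_le _ _).trans
      (add_le_add Finset.card_image_le Finset.card_image_le)).trans_lt ?_
    omega
  obtain ⟨t, -, ht⟩ := Finset.exists_mem_notMem_of_card_lt_card hB
  refine ⟨t, fun e he h => ht ?_, fun e he h => ht ?_⟩
  · exact Finset.mem_union_left _ (Finset.mem_image.mpr ⟨e, he, h⟩)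
  · exact Finset.mem_union_right _ (Finset.mem_image.mpr ⟨e, he, by simp [h]⟩)

/-! ### Edge-disjoint escape routes -/

open Classical in
/-- The label of the escape route from the left vertex at `z` on which an edge lies. -/
noncomputable def routeOf (i₀ : Fin m) (z : Cell m N) (e : Edge m N) : Fin (m + 1) :=
  if e.1 i₀ = z i₀ - 1 then 0
  else if e.2 ≠ 0 then e.2
  else if h : ∃ i, e.1 i ≠ z i then h.choose.succ
  else 0

theorem routeOf_of_eq_sub_one {i₀ : Fin m} {z : Cell m N} {e : Edge m N}
    (h : e.1 i₀ = z i₀ - 1) : routeOf i₀ z e = 0 := by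
  simp [routeOf, h]

theorem routeOf_start [Fact (1 < N)] (i₀ : Fin m) (z : Cell m N) : routeOf i₀ z (z, 0) = 0 := by
  simp [routeOf]

theorem routeOf_succ {i₀ i : Fin m} {z : Cell m N} {t : ZMod N}
    (h : (z + Pi.single i t : Cell m N) i₀ ≠ z i₀ - 1) :
    routeOf i₀ z (z + Pi.single i t, i.succ) = i.succ := by
  rw [routeOf, if_neg h, if_pos (Fin.succ_ne_zero i)]

theorem routeOf_zero {i₀ i : Fin m} {z : Cell m N} {t : ZMod N} (ht : t ≠ 0)
    (h : (z + Pi.single i t : Cell m N) i₀ ≠ z i₀ - 1) :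
    routeOf i₀ z (z + Pi.single i t, 0) = i.succ := by
  have hex : ∃ i', (z + Pi.single i t : Cell m N) i' ≠ z i' := ⟨i, by simpa using ht⟩
  rw [routeOf, if_neg h, if_neg (by simp), dif_pos hex]
  have hne := hex.choose_spec
  congr 1
  by_contra hi
  exact hne (by rw [Pi.add_apply, Pi.single_eq_of_ne hi, add_zero])

/-- A left vertex at which all hyperplanes are free can escape when at most `m` further edges
are blocked. -/
theorem exists_safe_flow (hm : 2 ≤ m) {F₀ F₁ F : Finset (Edge m N)} {z : Cell m N}
    (hz : ∀ j, FreeAt F₀ j (z j) ∧ FreeAt F₀ j (z j - 1)) (hF : F ⊆ F₀ ∪ F₁)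
    (h₁ : F₁.card ≤ m) (hN : F.card + 1 < N) : ∃ w, Safe F w ∧ Flow F (z, false) w := by
  have : Fact (1 < N) := ⟨by omega⟩
  have : NeZero N := ⟨by omega⟩
  have : Nontrivial (Fin m) := Fin.nontrivial_iff_two_le.mpr hm
  obtain ⟨i₀⟩ : Nonempty (Fin m) := inferInstance
  -- Pigeonhole: there are `m + 1` routes, and the at most `m` edges of `F₁` leave some route `l`
  -- untouched.
  have hdisj {e} (h0 : e ∉ F₀) (h1 : e ∉ F₁) : e ∉ F := fun h =>
    (Finset.mem_union.mp (hF h)).elim h0 h1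
  obtain ⟨l, -, hl⟩ := Finset.exists_mem_notMem_of_card_lt_card
    (s := F₁.image (routeOf i₀ z)) (t := Finset.univ)
    (by rw [Finset.card_univ, Fintype.card_fin]; exact (Finset.card_image_le.trans h₁).trans_lt
          (Nat.lt_succ_self m))
  have hroute {e} (he : routeOf i₀ z e = l) : e ∉ F₁ := fun h =>
    hl (Finset.mem_image.mpr ⟨e, h, he⟩)
  obtain rfl | ⟨i, rfl⟩ := l.eq_zero_or_eq_succ
  -- Route `0` crosses to the right vertex at `z` and steps back into the hyperplane at `z i₀ - 1`.
  -- That whole hyperplane is assigned to this route, so the endpoint is safe.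
  · let g : Cell m N := z - Pi.single i₀ 1
    have hg : g i₀ = z i₀ - 1 := by simp [g]
    refine ⟨(g, false), ⟨i₀, fun e he h => ?_⟩, ?_⟩
    · rcases Finset.mem_union.mp (hF he) with h0 | h1
      · exact (hz i₀).2 e h0 (h.trans hg)
      · exact hroute (routeOf_of_eq_sub_one (h.trans hg)) h1
    · have h1 : Flow F (z, false) (z, true) :=
        Flow.sides (hdisj ((hz i₀).1.notMem 0) (hroute (routeOf_start i₀ z)))
      have h2 : Flow F (g, false) (g + shift i₀.succ, true) := by
        refine Flow.edge (hdisj ?_ (hroute (routeOf_of_eq_sub_one hg)))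
        exact FreeAt.notMem (j := i₀) (by simpa [hg] using (hz i₀).2) _
      rw [shift_succ, sub_add_cancel] at h2
      exact h1.trans h2.symm
  -- Route `i.succ` zigzags from `z` in direction `i`. It stays in the hyperplane `x_j = z j`, which
  -- is free of `F₀`, and stops before using an edge that starts at `z i₀ - 1`.
  · obtain ⟨j, hj⟩ := exists_ne i
    have hz' (t : ZMod N) (l) : (z + Pi.single i t, l) ∉ F₀ :=
      FreeAt.notMem (j := j) (by simpa [hj] using (hz j).1) l
    have hline (n : ℕ) (hn : n + 1 < N) :
        (z + Pi.single i (n : ZMod N) : Cell m N) i₀ ≠ z i₀ - 1 := by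
      intro h
      by_cases hi : i₀ = i
      · subst hi
        rw [Pi.add_apply, Pi.single_eq_same, sub_eq_add_neg, add_right_inj,
          eq_neg_iff_add_eq_zero, ← Nat.cast_succ, ZMod.natCast_eq_zero_iff] at h
        exact absurd (Nat.le_of_dvd n.succ_pos h) (by omega)
      · rw [Pi.add_apply, Pi.single_eq_of_ne hi, add_zero, eq_comm, sub_eq_self] at h
        exact one_ne_zero h
    have hflow (n : ℕ) (hn : n + 1 < N) :
        Flow F (z, false) (z + Pi.single i ((n + 1 : ℕ) : ZMod N), true) := by
      have hstep (n : ℕ) (hn : n + 1 < N) : Flow F (z + Pi.single i (n : ZMod N), false)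
          (z + Pi.single i ((n + 1 : ℕ) : ZMod N), true) := by
        have := Flow.edge (hdisj (hz' n i.succ) (hroute (routeOf_succ (hline n hn))))
        rwa [shift_succ, add_assoc, ← Pi.single_add, ← Nat.cast_succ] at this
      induction n with
      | zero => simpa using hstep 0 hn
      | succ n ih =>
        refine (ih (by omega)).trans (Flow.trans ?_ (hstep (n + 1) hn))
        refine (Flow.sides (hdisj (hz' _ 0) (hroute (routeOf_zero ?_ (hline _ hn))))).symm
        rw [Ne, ZMod.natCast_eq_zero_iff]
        exact fun h => absurd (Nat.le_of_dvd n.succ_pos h) (by omega)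
    -- The route ends at the first coordinate of a free hyperplane other than `z i` itself; `N - 1 >
    -- F.card` values are available.
    obtain ⟨t, ht, hfree⟩ := exists_freeAt F i (Finset.univ.erase (z i))
      (by rw [Finset.card_erase_of_mem (Finset.mem_univ _), Finset.card_univ, ZMod.card]; omega)
    have ht0 : (t - z i).val ≠ 0 := by
      rw [Ne, ZMod.val_eq_zero, sub_eq_zero]
      exact Finset.ne_of_mem_erase ht
    obtain ⟨n, hn⟩ := Nat.exists_eq_succ_of_ne_zero ht0
    have hlt := (t - z i).val_lt
    refine ⟨_, ⟨i, ?_⟩, hflow n (by omega)⟩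
    have : ((n + 1 : ℕ) : ZMod N) = t - z i := by
      rw [← Nat.succ_eq_add_one, ← hn, ZMod.natCast_val, ZMod.cast_id]
    simpa [this] using hfree

end Torus

/-! ### Structures with a single relation -/

/-- The vocabulary with a single relation symbol, of arity `q`. -/
abbrev singleLang (q : ℕ) : FirstOrder.Language.{0, 0} :=
  ⟨fun _ => Empty, fun n => PLift (n = q)⟩

instance (q : ℕ) : (singleLang q).IsRelational := fun _ => inferInstanceAs (IsEmpty Empty)

instance (q : ℕ) : Finite (Σ n, (singleLang q).Relations n) := by
  refine Finite.of_injective (β := Unit) (fun _ => ()) ?_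
  rintro ⟨_, ⟨rfl⟩⟩ ⟨_, ⟨rfl⟩⟩ _
  rfl

/-- The relation symbol of `singleLang q`. -/
abbrev singleSymb (q : ℕ) : (singleLang q).Relations q := ⟨rfl⟩

/-- The structure whose relation consists of the tuples in `S`. -/
def singleStr {q : ℕ} (U : Type) [Finite U] [Nonempty U] (S : Set (Fin q → U)) :
    FinStr (singleLang q) :=
  ⟨U, relStructure (singleLang q) U fun R x => (x ∘ Fin.cast R.down.symm) ∈ S, ‹_›, ‹_›⟩

theorem nonempty_hom_singleStr {q : ℕ} {A : FinStr (singleLang q)} {U : Type} [Finite U]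
    [Nonempty U] {S : Set (Fin q → U)} :
    Nonempty (A.carrier →[singleLang q] (singleStr U S).carrier) ↔
      ∃ h : A.carrier → U, ∀ x, Structure.RelMap (singleSymb q) x → h ∘ x ∈ S := by
  constructor
  · rintro ⟨f⟩
    exact ⟨f, fun x hx => f.map_rel (singleSymb q) x hx⟩
  · rintro ⟨h, hh⟩
    refine ⟨⟨h, fun F => isEmptyElim F, fun R x => ?_⟩⟩
    obtain ⟨rfl⟩ := R
    exact hh x

theorem nonempty_singleStr_hom_singleStr {q : ℕ} {U V : Type} [Finite U] [Nonempty U] [Finite V]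
    [Nonempty V] {S : Set (Fin q → U)} {T : Set (Fin q → V)} :
    Nonempty ((singleStr U S).carrier →[singleLang q] (singleStr V T).carrier) ↔
      ∃ h : U → V, ∀ x ∈ S, h ∘ x ∈ T :=
  nonempty_hom_singleStr

/-! ### The template -/

/-- The coordinates of the relation: for each `i : Fin d` there are two coordinates for the
`i`-th bit and its negation, and `D` coordinates for pairs of bits. -/
abbrev Coord (d D : ℕ) := Fin d × (Fin D ⊕ Bool)

/-- The elements of the template are bits and pairs of bits. -/
abbrev Bits := ZMod 2 ⊕ ZMod 2 × ZMod 2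

/-- The index congruent to `i + (s + 1) * p` modulo `d`. -/
def partner {d : ℕ} (p : ℕ) (i : Fin d) (s : ℕ) : Fin d :=
  ⟨(i + (s + 1) * p) % d, Nat.mod_lt _ i.pos⟩

theorem exists_partner_eq {d D p : ℕ} (hp : 0 < p) (hD : d / p ≤ D) {i j : Fin d} (hij : i < j)
    (h : (i : ℕ) % p = j % p) : ∃ s : Fin D, partner p i s = j := by
  have hij' : (i : ℕ) < j := hij
  obtain ⟨t, ht⟩ := (Nat.modEq_iff_dvd' hij'.le).mp h
  obtain _ | s := t
  · omega
  have hs : s + 1 ≤ D := by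
    refine le_trans ((Nat.le_div_iff_mul_le hp).mpr ?_) hD
    rw [mul_comm, ← ht]
    omega
  refine ⟨⟨s, hs⟩, Fin.ext ?_⟩
  have : (i : ℕ) + (s + 1) * p = j := by
    rw [mul_comm, ← ht]
    omega
  simp only [partner]
  rw [this, Nat.mod_eq_of_lt j.isLt]

/-- The constant added to a bit at the two coordinates for single bits. -/
def signBit (s : Bool) : ZMod 2 := if s then 1 else 0

/-- The tuple over the template that encodes a bit string. -/
def code {d : ℕ} (D p : ℕ) (x : Fin d → ZMod 2) : Coord d D → Bits
  | (i, .inl s) => .inr (x i, x (partner p i s))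
  | (i, .inr s) => .inl (x i + signBit s)

/-- The relation of the template: the codes of the bit strings of even parity. -/
def evenCodes {d q D : ℕ} (p : ℕ) (e : Fin q ≃ Coord d D) : Set (Fin q → Bits) :=
  {t | ∃ x : Fin d → ZMod 2, ∑ i, x i = 0 ∧ t = code D p x ∘ e}

/-- The predicate `P` fails at most once. -/
def FailsOnce {ι : Type*} (P : ι → Prop) : Prop := ∀ s t, ¬ P s → ¬ P t → s = t

theorem FailsOnce.mono {ι : Type*} {P P' : ι → Prop} (h : FailsOnce P) (hP : ∀ i, P i → P' i) :
    FailsOnce P' :=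
  fun s t hs ht => h s t (mt (hP s) hs) (mt (hP t) ht)

/-- Two predicates fail at no more than two of at least three indices. -/
theorem FailsOnce.exists_and {ℓ : ℕ} (hℓ : 3 ≤ ℓ) {P P' : Fin ℓ → Prop} (h : FailsOnce P)
    (h' : FailsOnce P') : ∃ t, P t ∧ P' t := by
  by_contra! hc
  let a : Fin ℓ := ⟨0, by omega⟩
  let b : Fin ℓ := ⟨1, by omega⟩
  let c : Fin ℓ := ⟨2, by omega⟩
  have hab : a ≠ b := by simp [a, b]
  have hac : a ≠ c := by simp [a, c]
  have hbc : b ≠ c := by simp [b, c]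
  have hor (t) : ¬ P t ∨ ¬ P' t := not_and_or.mp fun ht => hc t ht.1 ht.2
  rcases hor a with ha | ha <;> rcases hor b with hb | hb <;> rcases hor c with hc | hc <;>
    first
    | exact hab (h _ _ ha hb)
    | exact hab (h' _ _ ha hb)
    | exact hac (h _ _ ha hc)
    | exact hac (h' _ _ ha hc)
    | exact hbc (h _ _ hb hc)
    | exact hbc (h' _ _ hb hc)

theorem failsOnce_of_mem_nearUnanimity {ℓ : ℕ} (hℓ : 3 ≤ ℓ) {A : Type} {a : Fin ℓ → A} {c : A}
    (h : c ∈ nearUnanimity ℓ A a) : FailsOnce fun t => a t = c := by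
  rw [mem_nearUnanimity hℓ] at h
  intro s t hs ht
  by_contra hst
  have h1 : {i | a i = c} ⊆ {s, t}ᶜ := by
    rintro i hi (rfl | rfl)
    exacts [hs hi, ht hi]
  have h2 := Set.ncard_le_ncard h1 (Set.toFinite _)
  have h3 := Set.ncard_add_ncard_compl ({s, t} : Set (Fin ℓ))
  rw [Set.ncard_pair hst, Nat.card_fin] at h3
  omega

/-- The codes of bit strings of even parity are closed under partial near-unanimity. -/
theorem mem_evenCodes_of_failsOnce {d q D ℓ : ℕ} (hℓ : 3 ≤ ℓ) (hD : d / (ℓ - 1) ≤ D)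
    (e : Fin q ≃ Coord d D) (a : Fin ℓ → Fin q → Bits) (ha : ∀ t, a t ∈ evenCodes (ℓ - 1) e)
    (b : Fin q → Bits) (hb : ∀ j, FailsOnce fun t => a t j = b j) :
    b ∈ evenCodes (ℓ - 1) e := by
  choose x hx hax using ha
  have hb' (j : Coord d D) : FailsOnce fun t => code D (ℓ - 1) (x t) j = b (e.symm j) := by
    simpa [hax] using hb (e.symm j)
  have hy (i : Fin d) : ∃ c, b (e.symm (i, .inr false)) = .inl c := by
    obtain ⟨t, ht, -⟩ := (hb' (i, .inr false)).exists_and hℓ (hb' (i, .inr false))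
    exact ⟨_, ht.symm⟩
  choose y hy using hy
  have hxy (i : Fin d) : FailsOnce fun t => x t i = y i := by
    refine (hb' (i, .inr false)).mono fun t ht => ?_
    rw [hy] at ht
    simpa [code, signBit] using ht
  have hcode (j : Coord d D) : b (e.symm j) = code D (ℓ - 1) y j := by
    obtain ⟨i, s | s⟩ := j
    -- The two components of the pair are read off in possibly different rows, both of which agree
    -- with `b` at this coordinate.
    · obtain ⟨t, h1, h2⟩ := (hb' (i, .inl s)).exists_and hℓ (hxy i)
      obtain ⟨t', h1', h2'⟩ := (hb' (i, .inl s)).exists_and hℓ (hxy (partner (ℓ - 1) i s))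
      have h3 := h1.trans h1'.symm
      simp only [code, Sum.inr.injEq, Prod.mk.injEq] at h3
      rw [← h1]
      simp only [code]
      rw [h2, h3.2, h2']
    · obtain ⟨t, h1, h2⟩ := (hb' (i, .inr s)).exists_and hℓ (hxy i)
      rw [← h1]
      simp only [code]
      rw [h2]
  refine ⟨y, ?_, funext fun j => by simpa using hcode (e j)⟩
  by_cases h : ∃ t, x t = y
  · obtain ⟨t, rfl⟩ := h
    exact hx t
  exfalso
  push Not at h
  choose i hi using fun t => Function.ne_iff.mp (h t)
  have hp : 0 < ℓ - 1 := by omega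
  -- Each of the `ℓ` rows differs from `y` at some index, and there are only `ℓ - 1` residues.
  obtain ⟨s, t, hst, hmod⟩ := Fintype.exists_ne_map_eq_of_card_lt
    (fun t => (⟨i t % (ℓ - 1), Nat.mod_lt _ hp⟩ : Fin (ℓ - 1))) (by simp; omega)
  replace hmod : (i s : ℕ) % (ℓ - 1) = i t % (ℓ - 1) := congrArg Fin.val hmod
  have key (s t : Fin ℓ) (hlt : i s < i t) (hmod : (i s : ℕ) % (ℓ - 1) = i t % (ℓ - 1)) :
      s = t := by
    obtain ⟨u, hu⟩ := exists_partner_eq hp hD hlt hmod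
    refine hb' (i s, .inl u) s t ?_ ?_
    · rw [hcode]
      simp only [code, Sum.inr.injEq, Prod.mk.injEq]
      exact fun h => hi s h.1
    · rw [hcode]
      simp only [code, Sum.inr.injEq, Prod.mk.injEq]
      exact fun h => hi t (hu ▸ h.2)
  rcases lt_trichotomy (i s) (i t) with hlt | heq | hlt
  · exact hst (key s t hlt hmod)
  · exact hst (hxy (i s) s t (hi s) (heq ▸ hi t))
  · exact hst (key t s hlt hmod.symm).symm

/-- The CSP quantifier with the given codes as template. -/
def parityQuantifier {d q D : ℕ} (p : ℕ) (e : Fin q ≃ Coord d D) : Quantifier where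
  voc := singleLang q
  relational := inferInstance
  finite_voc := inferInstance
  cls := {A | Nonempty (A.carrier →[singleLang q] (singleStr Bits (evenCodes p e)).carrier)}
  iso_closed := fun _ _ ⟨f⟩ ⟨g⟩ => ⟨f.comp g.symm.toHom⟩

theorem parityQuantifier_mem {d q D ℓ : ℕ} (hℓ : 3 ≤ ℓ) (hD : d / (ℓ - 1) ≤ D)
    (e : Fin q ≃ Coord d D) : parityQuantifier (ℓ - 1) e ∈ nuCSPQuantifiers ℓ q := by
  refine ⟨⟨?_, ⟨_, fun A => Iff.rfl⟩⟩, ?_⟩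
  · intro U hf hn A B hB hAB
    obtain ⟨h, hh⟩ := nonempty_hom_singleStr.mp hB
    refine nonempty_hom_singleStr.mpr ⟨h, fun x hx => ?_⟩
    obtain hx | ⟨a, ha, hax⟩ := hAB q (singleSymb q) x hx
    · exact hh x hx
    · refine mem_evenCodes_of_failsOnce hℓ hD e (fun t => h ∘ a t) (fun t => hh _ (ha t)) _
        fun j => ?_
      exact (failsOnce_of_mem_nearUnanimity hℓ (hax j)).mono fun t ht => congrArg h ht
  · rintro n ⟨⟨rfl⟩⟩
    exact le_rfl

/-! ### The parity structures over the graph -/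

/-- The elements of the parity structures: a bit for an edge, or a pair of bits for a pair of
edges at a vertex. -/
abbrev Elem (m N : ℕ) :=
  (Edge m N × ZMod 2) ⊕ (Vertex m N × Fin (m + 1) × Fin (m + 1)) × ZMod 2 × ZMod 2

/-- The tuple at the vertex `v` for the values `x` of the edges at `v`. -/
def gadget {m N : ℕ} (D p : ℕ) (v : Vertex m N) (x : Fin (m + 1) → ZMod 2) :
    Coord (m + 1) D → Elem m N
  | (i, .inl s) => .inr ((v, i, partner p i s), x i, x (partner p i s))
  | (i, .inr s) => .inl (edgeAt v i, x i + signBit s)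

/-- The relation in which the values of the edges at `v` have parity `b v`. -/
def gadgets {m N q D : ℕ} (p : ℕ) (e : Fin q ≃ Coord (m + 1) D) (b : Vertex m N → ZMod 2) :
    Set (Fin q → Elem m N) :=
  {t | ∃ v x, ∑ i, x i = b v ∧ t = gadget D p v x ∘ e}

theorem singleStr_gadgets_zero_mem {m N q D : ℕ} [NeZero N] (p : ℕ)
    (e : Fin q ≃ Coord (m + 1) D) :
    singleStr (Elem m N) (gadgets p e 0) ∈ (parityQuantifier p e).cls := by
  refine nonempty_singleStr_hom_singleStr.mpr ⟨Sum.map Prod.snd Prod.snd, ?_⟩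
  rintro _ ⟨v, x, hx, rfl⟩
  refine ⟨x, hx, funext fun j => ?_⟩
  simp only [Function.comp_apply]
  obtain ⟨i, s | s⟩ := e j <;> rfl

theorem singleStr_gadgets_notMem {m N q D : ℕ} [NeZero N] (p : ℕ)
    (e : Fin q ≃ Coord (m + 1) D) {b : Vertex m N → ZMod 2} (hb : ∑ v, b v ≠ 0) :
    singleStr (Elem m N) (gadgets p e b) ∉ (parityQuantifier p e).cls := by
  intro hmem
  obtain ⟨h, hh⟩ := nonempty_singleStr_hom_singleStr.mp hmem
  -- The default `0` for pairs is never reached, by `hval`.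
  let c (e : Edge m N) : ZMod 2 := (h (.inl (e, 0))).elim id fun _ => 0
  refine hb ((Finset.sum_congr rfl fun v _ => ?_).trans (sum_boundary c))
  let x : Fin (m + 1) → ZMod 2 := Pi.single 0 (b v)
  have hx : ∑ i, x i = b v := by simp [x]
  obtain ⟨y, hy, hxy⟩ := hh _ ⟨v, x, hx, rfl⟩
  have hval (i s) : h (.inl (edgeAt v i, x i + signBit s)) = .inl (y i + signBit s) := by
    have := congrFun hxy (e.symm (i, .inr s))
    simpa [gadget, code] using this
  have hc (i) : c (edgeAt v i) = x i + y i := by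
    -- The coordinate with sign `x i` carries the element `(edgeAt v i, 0)`, so `c` can be read off
    -- at both ends of an edge.
    have hs : ∃ s, x i = signBit s := by
      generalize x i = a
      revert a
      decide
    obtain ⟨s, hs⟩ := hs
    have := hval i s
    rw [hs, CharTwo.add_self_eq_zero] at this
    rw [hs, add_comm]
    simp only [c, this, Sum.elim_inl, id]
  rw [boundary, Finset.sum_congr rfl fun i _ => hc i, Finset.sum_add_distrib, hx, hy, add_zero]

/-- The edges to which an element refers. -/
def edgesOf {m N : ℕ} : Elem m N → Finset (Edge m N)
  | .inl (e, _) => {e}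
  | .inr ((v, i, j), _) => {edgeAt v i, edgeAt v j}

theorem card_edgesOf_le {m N : ℕ} (a : Elem m N) : (edgesOf a).card ≤ 2 := by
  obtain ⟨e, _⟩ | ⟨⟨v, i, j⟩, _⟩ := a
  · simp [edgesOf]
  · exact Finset.card_le_two

/-- The edges to which the elements of a tuple refer. -/
def tupleEdges {m N k : ℕ} (α : Fin k → Elem m N) : Finset (Edge m N) :=
  Finset.univ.biUnion fun i => edgesOf (α i)

theorem card_tupleEdges_le {m N k : ℕ} (α : Fin k → Elem m N) : (tupleEdges α).card ≤ k * 2 := by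
  simpa [tupleEdges] using Finset.card_biUnion_le_card_mul Finset.univ (fun i => edgesOf (α i)) 2
    fun i _ => card_edgesOf_le _

theorem tupleEdges_extend_subset {m N k n : ℕ} (y : Fin n ↪ Fin k) (b : Fin n → Elem m N)
    (α : Fin k → Elem m N) :
    tupleEdges (Function.extend y b α) ⊆ tupleEdges α ∪ tupleEdges b := by
  intro e he
  obtain ⟨i, -, hi⟩ := Finset.mem_biUnion.mp he
  by_cases h : ∃ j, y j = i
  · obtain ⟨j, rfl⟩ := h
    rw [y.injective.extend_apply] at hi
    exact Finset.mem_union_right _ (Finset.mem_biUnion.mpr ⟨j, Finset.mem_univ _, hi⟩)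
  · rw [Function.extend_apply' _ _ _ h] at hi
    exact Finset.mem_union_left _ (Finset.mem_biUnion.mpr ⟨i, Finset.mem_univ _, hi⟩)

/-! ### Flips and the duplicator's strategy -/

/-- Adding `c` to the values of the edges. -/
def flip {m N : ℕ} (c : Edge m N → ZMod 2) : Elem m N → Elem m N
  | .inl (e, a) => .inl (e, a + c e)
  | .inr ((v, i, j), a, a') => .inr ((v, i, j), a + c (edgeAt v i), a' + c (edgeAt v j))

theorem flip_flip {m N : ℕ} (c : Edge m N → ZMod 2) (a : Elem m N) : flip c (flip c a) = a := by
  obtain ⟨e, _⟩ | ⟨⟨v, i, j⟩, _, _⟩ := a <;>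
    simp [flip, add_assoc, CharTwo.add_self_eq_zero]

/-- `flip` as a permutation. -/
def flipEquiv {m N : ℕ} (c : Edge m N → ZMod 2) : Elem m N ≃ Elem m N :=
  ⟨flip c, flip c, flip_flip c, flip_flip c⟩

theorem flip_add_of_forall {m N : ℕ} (c : Edge m N → ZMod 2) {c' : Edge m N → ZMod 2}
    {a : Elem m N} (h : ∀ e ∈ edgesOf a, c' e = 0) : flip (c + c') a = flip c a := by
  obtain ⟨e, _⟩ | ⟨⟨v, i, j⟩, _, _⟩ := a <;> simp_all [flip, edgesOf]

theorem flip_add_comp {m N k : ℕ} (c : Edge m N → ZMod 2) {c' : Edge m N → ZMod 2}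
    {α : Fin k → Elem m N} (h : ∀ e ∈ tupleEdges α, c' e = 0) :
    flip (c + c') ∘ α = flip c ∘ α :=
  funext fun i => flip_add_of_forall c fun e he =>
    h e (Finset.mem_biUnion.mpr ⟨i, Finset.mem_univ _, he⟩)

theorem edgesOf_flip {m N : ℕ} (c : Edge m N → ZMod 2) (a : Elem m N) :
    edgesOf (flip c a) = edgesOf a := by
  obtain ⟨e, _⟩ | ⟨⟨v, i, j⟩, _, _⟩ := a <;> rfl

theorem tupleEdges_flip {m N k : ℕ} (c : Edge m N → ZMod 2) (α : Fin k → Elem m N) :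
    tupleEdges (flip c ∘ α) = tupleEdges α := by
  simp [tupleEdges, edgesOf_flip]

theorem flip_gadget {m N D : ℕ} (p : ℕ) (c : Edge m N → ZMod 2) (v : Vertex m N)
    (x : Fin (m + 1) → ZMod 2) :
    flip c ∘ gadget D p v x = gadget D p v (x + fun i => c (edgeAt v i)) := by
  ext1 ⟨i, s | s⟩
  · rfl
  · simp [gadget, flip, add_right_comm]

theorem Safe.exists_edgeAt_notMem {m N : ℕ} {F : Finset (Edge m N)} {v : Vertex m N}
    (h : Safe F v) : ∃ l, edgeAt v l ∉ F := by
  obtain ⟨j, hj⟩ := h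
  exact ⟨0, FreeAt.notMem (j := j) (by simpa [edgeAt] using hj) 0⟩

/-- Flipping maps gadgets to gadgets, except possibly at a vertex with an untouched edge. -/
theorem flip_mem_gadgets {m N q D k : ℕ} {p : ℕ} {e : Fin q ≃ Coord (m + 1) D}
    {b b' : Vertex m N → ZMod 2} {c : Edge m N → ZMod 2} {w : Vertex m N}
    (hc : b + boundary c = b' + Pi.single w 1) {α : Fin k → Elem m N}
    (hw : Safe (tupleEdges α) w) {x : Fin q → Fin k} (h : α ∘ x ∈ gadgets p e b) :
    (flip c ∘ α) ∘ x ∈ gadgets p e b' := by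
  obtain ⟨v, y, hy, hxy⟩ := h
  have hvw : v ≠ w := by
    rintro rfl
    obtain ⟨l, hl⟩ := hw.exists_edgeAt_notMem
    -- A tuple of the relation mentions every edge at its vertex, so it cannot sit at a vertex with
    -- an untouched edge.
    refine hl (Finset.mem_biUnion.mpr ⟨x (e.symm (l, .inr false)), Finset.mem_univ _, ?_⟩)
    have := congrFun hxy (e.symm (l, .inr false))
    simp only [Function.comp_apply, Equiv.apply_symm_apply, gadget] at this
    rw [this]
    simp [edgesOf]
  refine ⟨v, y + fun i => c (edgeAt v i), ?_, ?_⟩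
  · have := congrFun hc v
    simp only [Pi.add_apply, Pi.single_eq_of_ne hvw, add_zero] at this
    rw [← this, ← hy]
    exact Finset.sum_add_distrib
  · rw [← flip_gadget, Function.comp_assoc, hxy, Function.comp_assoc]

/-- The positions in which the two tuples differ by a flip that is an isomorphism except at a safe
vertex. -/
def FlipPosition {m N k : ℕ} (u : Vertex m N) (α β : Fin k → Elem m N) : Prop :=
  ∃ c w, β = flip c ∘ α ∧ boundary c = Pi.single u 1 + Pi.single w 1 ∧ Safe (tupleEdges α) w

theorem FlipPosition.symm {m N k : ℕ} {u : Vertex m N} {α β : Fin k → Elem m N}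
    (h : FlipPosition u α β) : FlipPosition u β α := by
  obtain ⟨c, w, rfl, hc, hw⟩ := h
  exact ⟨c, w, funext fun i => (flip_flip c _).symm, hc, by rwa [tupleEdges_flip]⟩

theorem FlipPosition.mem_gadgets_iff {m N q D k : ℕ} {u : Vertex m N} {α β : Fin k → Elem m N}
    (h : FlipPosition u α β) {p : ℕ} {e : Fin q ≃ Coord (m + 1) D} {x : Fin q → Fin k} :
    α ∘ x ∈ gadgets p e 0 ↔ β ∘ x ∈ gadgets p e (Pi.single u 1) := by
  constructor
  · obtain ⟨c, w, rfl, hc, hw⟩ := h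
    exact flip_mem_gadgets (by rw [hc, zero_add]) hw
  · obtain ⟨c, w, rfl, hc, hw⟩ := h.symm
    refine flip_mem_gadgets ?_ hw
    rw [hc]
    ext v
    simp [← add_assoc, CharTwo.add_self_eq_zero]

/-- The bijection is fixed before `b` is known, so it first moves the defect to `z`, away from the
edges of `α`; the escape from `z` then depends on `b`. Since `k` elements touch at most `2k` edges,
`4k + 2 ≤ N` leaves enough free hyperplanes. -/
theorem FlipPosition.exists_extend {m N k r : ℕ} [NeZero N] (hm : 2 ≤ m) (hr : 2 * r ≤ m)
    (hN : 4 * k + 2 ≤ N) {u : Vertex m N} {α β : Fin k → Elem m N} (h : FlipPosition u α β) :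
    ∃ c, ∀ n ≤ r, ∀ (y : Fin n ↪ Fin k) (b : Fin n → Elem m N),
      FlipPosition u (Function.extend y b α) (Function.extend y (flip c ∘ b) β) := by
  obtain ⟨c, w, rfl, hc, hw⟩ := h
  have hcard := card_tupleEdges_le α
  obtain ⟨z, hz⟩ := exists_forall_freeAt (tupleEdges α) (by omega)
  obtain ⟨c', h0, hc'⟩ := hw.flow_of_forall_freeAt hm fun j => (hz j).1
  refine ⟨c + c', fun n hn y b => ?_⟩
  have hcard' := card_tupleEdges_le (Function.extend y b α)
  have hcardb := card_tupleEdges_le b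
  obtain ⟨w', hw', c'', h0', hc''⟩ := exists_safe_flow hm hz
    (tupleEdges_extend_subset y b α) (by omega) (by omega)
  refine ⟨c + c' + c'', w', ?_, ?_, hw'⟩
  · rw [flip_add_comp _ h0', ← flip_add_comp c h0]
    exact (funext fun i => Function.apply_extend (flip (c + c')) _ _ i).symm
  · rw [boundary_add, boundary_add, hc, hc', hc'']
    ext v
    simp only [Pi.add_apply]
    linear_combination CharTwo.add_self_eq_zero ((Pi.single w 1 : Vertex m N → ZMod 2) v) +
      CharTwo.add_self_eq_zero ((Pi.single (z, false) 1 : Vertex m N → ZMod 2) v)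

theorem exists_flipPosition {m N k : ℕ} [NeZero N] (hm : 2 ≤ m) (hN : 4 * k + 2 ≤ N)
    (u : Vertex m N) (β : Fin k → Elem m N) : ∃ α, FlipPosition u α β := by
  have hcard := card_tupleEdges_le β
  obtain ⟨z, hz⟩ := exists_forall_freeAt (tupleEdges β) (by omega)
  have hu : Safe (∅ : Finset (Edge m N)) u := ⟨⟨0, by omega⟩, by simp [FreeAt]⟩
  obtain ⟨c, -, hc⟩ := hu.flow_of_forall_freeAt hm (z := z) fun j => by simp [FreeAt]
  exact ⟨flip c ∘ β, FlipPosition.symm ⟨c, _, rfl, hc, ⟨0, by omega⟩, (hz _).1⟩⟩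

theorem bijectiveStrategy_flipPosition {m N q D k r : ℕ} [NeZero N] (hm : 2 ≤ m)
    (hr : 2 * r ≤ m) (hN : 4 * k + 2 ≤ N) (p : ℕ) (e : Fin q ≃ Coord (m + 1) D)
    (u : Vertex m N) :
    BijectiveStrategy (singleStr (Elem m N) (gadgets p e 0))
      (singleStr (Elem m N) (gadgets p e (Pi.single u 1))) r k (FlipPosition u) where
  eq_iff := by
    rintro α _ ⟨c, w, rfl, -, -⟩ x y
    exact ((flipEquiv c).injective.eq_iff).symm
  rel_iff := by
    rintro α β h n ⟨rfl⟩ x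
    exact h.mem_gadgets_iff
  bijection := by
    intro α β h
    obtain ⟨c, hc⟩ := h.exists_extend hm hr hN
    exact ⟨flipEquiv c, hc⟩

/-! ### The separating sentence -/

/-- The sentence that applies the parity quantifier to the relation itself. -/
def paritySentence {d q D p : ℕ} (e : Fin q ≃ Coord d D) {𝒬 : Set Quantifier}
    (h : parityQuantifier p e ∈ 𝒬) : Sentence (singleLang q) 𝒬 where
  numVars := q
  formula := .quant (parityQuantifier p e) h (fun R => (finCongr R.down).toEmbedding)
    fun R => .rel R (finCongr R.down)
  closed := by
    simp only [Formula.freeVars, Set.iUnion_eq_empty]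
    intro n R
    exact sdiff_self

theorem paritySentence_models {d q D p : ℕ} (e : Fin q ≃ Coord d D) {𝒬 : Set Quantifier}
    (h : parityQuantifier p e ∈ 𝒬) (A : FinStr (singleLang q)) :
    (paritySentence e h).Models A ↔ A ∈ (parityQuantifier p e).cls := by
  have hA (α : Fin q → A.carrier) :
      (paritySentence e h).formula.Holds A α ↔ A ∈ (parityQuantifier p e).cls := by
    refine (parityQuantifier p e).mem_iff_of_equiv _ _ (Equiv.refl _) fun R x => ?_
    refine iff_of_eq (congrArg (A.str.RelMap R) (funext fun i => ?_))
    exact ((finCongr R.down).injective.extend_apply x α i).symm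
  obtain ⟨a⟩ := A.nonempty
  exact ⟨fun hα => (hA fun _ => a).mp (hα _), fun hmem α => (hA α).mpr hmem⟩

theorem not_logicLE_of_parityQuantifier_mem {m q D p r : ℕ} (hm : 2 ≤ m) (hr : 1 ≤ r)
    (hrm : 2 * r ≤ m) (e : Fin q ≃ Coord (m + 1) D) {𝒬 : Set Quantifier}
    (h : parityQuantifier p e ∈ 𝒬) : ¬ LogicLE 𝒬 (quantifiersOfArity r) := by
  intro hle
  obtain ⟨ψ, hψ⟩ := hle (singleLang q) (paritySentence e h)
  simp only [paritySentence_models] at hψ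
  -- Only the side of the torus depends on `ψ`; the degree `m + 1` was fixed together with the
  -- quantifier.
  let N := 4 * ψ.numVars + 2
  have : NeZero N := ⟨by omega⟩
  let u : Vertex m N := (0, false)
  have hstrat := bijectiveStrategy_flipPosition (k := ψ.numVars) hm hrm le_rfl p e u
  have h0 := (hψ _).mp (singleStr_gadgets_zero_mem (m := m) (N := N) p e)
  refine singleStr_gadgets_notMem (m := m) (N := N) p e (b := Pi.single u 1) (by simp)
    ((hψ _).mpr fun β => ?_)
  obtain ⟨α, hα⟩ := exists_flipPosition hm le_rfl u β
  exact (hstrat.holds_iff hr ψ.formula hα).mp (h0 α)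

end PolyQuant

theorem mainTheorem3 (r ℓ : ℕ) (hℓ : 3 ≤ ℓ) (hr : ℓ ≤ r) :
    ¬ PolyQuant.LogicLE (PolyQuant.nuCSPQuantifiers ℓ (PolyQuant.separationArity r ℓ))
        (PolyQuant.quantifiersOfArity r) ∧
      ∃ r' : ℕ, r < r' ∧
        PolyQuant.LogicLE (PolyQuant.nuCSPQuantifiers ℓ r) (PolyQuant.nuCSPQuantifiers ℓ r') ∧
        ¬ PolyQuant.LogicLE (PolyQuant.nuCSPQuantifiers ℓ r')
          (PolyQuant.nuCSPQuantifiers ℓ r) := by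
  open PolyQuant in
  have hmain : ¬ LogicLE (nuCSPQuantifiers ℓ (separationArity r ℓ)) (quantifiersOfArity r) := by
    -- Here `m = 2r`: each of the `2r + 1` bits has two signed coordinates and `⌊(2r+1)/(ℓ-1)⌋` pair
    -- coordinates.
    let e : Fin (separationArity r ℓ) ≃ Coord (2 * r + 1) ((2 * r + 1) / (ℓ - 1)) :=
      (Fintype.equivFinOfCardEq (by simp [separationArity])).symm
    exact not_logicLE_of_parityQuantifier_mem (by omega) (by omega) le_rfl e
      (parityQuantifier_mem hℓ le_rfl e)
  have hlt : r < PolyQuant.separationArity r ℓ := by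
    unfold PolyQuant.separationArity
    nlinarith [Nat.zero_le ((2 * r + 1) / (ℓ - 1))]
  refine ⟨hmain, _, hlt, .of_subset ?_, fun h => hmain (h.trans (.of_subset ?_))⟩
  · exact fun Q hQ => ⟨hQ.1, fun n hn => (hQ.2 n hn).trans hlt.le⟩
  · exact fun Q hQ => hQ.2
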